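/- For a group $G$ and an endomorphism $\varphi \in \operatorname{End}(G)$, call $x, y \in G$ \emph{$\varphi$-conjugate} if $x = z y \varphi(z)^{-1}$ for some $z \in G$. This is an equivalence relation, and the number of its equivalence classes, $R(\varphi) \in \{1, 2, 3, \ldots\} \cup \{\infty\}$, is called the \emph{Reidemeister number} of $\varphi$. For $g \in G$, the subgroup $\operatorname{Stab}_{\varphi}(g) = \{x \in G \mid x g \varphi(x)^{-1} = g\}$ is called the \emph{$\varphi$-twisted stabiliser} of $g$. Let $N$ be a finitely generated torsion-free nilpotent group and let $\varphi \in \operatorname{End}(N)$ be such that $R(\varphi) = \infty$. Then $\operatorname{Stab}_{\varphi}(n)$ is infinite for every $n \in N$. In particular, $\varphi$ has a non-trivial fixed point, i.e. there is an $x \in N$ with $x \neq 1$ and $\varphi(x) = x$. -/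

import Mathlib

/-- Two elements `x, y` of `G` are `φ`-conjugate if `x = z * y * (φ z)⁻¹` for some `z`;
this is an equivalence relation. -/
def twistedConjSetoid {G : Type*} [Group G] (φ : G →* G) : Setoid G where
  r x y := ∃ z : G, x = z * y * (φ z)⁻¹
  iseqv :=
    { refl := fun x => ⟨1, by simp⟩
      symm := by
        rintro x y ⟨z, rfl⟩
        exact ⟨z⁻¹, by simp [mul_assoc]⟩
      trans := by
        rintro x y w ⟨z, rfl⟩ ⟨z', rfl⟩
        exact ⟨z * z', by simp [mul_assoc]⟩ }

/-- The Reidemeister number `R(φ)`: the number of `φ`-conjugacy classes, with value `⊤` if there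
are infinitely many. -/
noncomputable def reidemeisterNumber {G : Type*} [Group G] (φ : G →* G) : ℕ∞ :=
  ENat.card (Quotient (twistedConjSetoid φ))

/-- The `φ`-twisted stabiliser of `g`, the subgroup of all `x` with `x * g * (φ x)⁻¹ = g`. -/
def twistedStabiliser {G : Type*} [Group G] (φ : G →* G) (g : G) : Subgroup G where
  carrier := {x | x * g * (φ x)⁻¹ = g}
  one_mem' := by simp
  mul_mem' := by
    intro a b ha hb
    simp only [Set.mem_ofPred_eq] at ha hb ⊢
    calc a * b * g * (φ (a * b))⁻¹ = a * (b * g * (φ b)⁻¹) * (φ a)⁻¹ := by simp [mul_assoc]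
      _ = g := by rw [hb, ha]
  inv_mem' := by
    intro a ha
    simp only [Set.mem_ofPred_eq] at ha ⊢
    calc a⁻¹ * g * (φ a⁻¹)⁻¹ = a⁻¹ * (a * g * (φ a)⁻¹) * (φ a⁻¹)⁻¹ := by rw [ha]
      _ = g := by simp [mul_assoc]

/-- A group is torsion-free if only its identity has finite order. (For non-commutative groups,
`IsMulTorsionFree` asks for more, namely that `n`-th roots are unique.) -/
def IsTorsionFreeGroup (G : Type*) [Group G] : Prop :=
  ∀ g : G, IsOfFinOrder g → g = 1

/-!
The result is the contrapositive of a statement about any finitely generated nilpotent group `G`: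
an endomorphism `φ` with finitely many fixed points has finitely many twisted conjugacy classes
(`exists_finite_twistedConj_of_isNilpotent`). Twisted stabilisers reduce to fixed points, since
the stabiliser of `n` is the set of fixed points of `x ↦ n * φ x * n⁻¹`, and right translation by
`n` carries the twisted conjugacy classes of that endomorphism to those of `φ`.

The proof is by induction on the nilpotency class. For abelian `G`, the fixed points and the
twisted classes are the kernel and the cokernel of `x ↦ x / φ x`, which have equal rank
(`LinearMap.finite_quotient_range_of_finite_ker`). In general let `K` be the last nontrivial term
of the lower central series. It is central, invariant under `φ`, and finitely generated
(`Subgroup.fg_lowerCentralSeries_of_succ_eq_bot`), so the abelian case gives a finite set `T` of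
representatives of `K` modulo the elements `k * (φ k)⁻¹`. A fixed point of the induced map on
`G ⧸ K` lifts to some `y` with `φ y = y * t` and `t ∈ T`, and for given `t` these `y` form at most
one coset of the fixed points of `φ`, so the induced map has finitely many fixed points as well
(`finite_fixedPoints_quotient`). By induction it has finitely many twisted classes, and each of
them splits into at most `#T` classes of `φ`, because `K` is central
(`exists_finite_twistedConj_of_quotient`).
-/

/-! ### Endomorphisms of finitely generated abelian groups -/

/-- An endomorphism of a finitely generated abelian group with finite kernel has finite cokernel,
as its kernel and its cokernel have the same rank. -/
theorem LinearMap.finite_quotient_range_of_finite_ker {M : Type*} [AddCommGroup M]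
    [Module.Finite ℤ M] (f : M →ₗ[ℤ] M) [Finite (LinearMap.ker f)] :
    Finite (M ⧸ LinearMap.range f) := by
  have hker : Module.finrank ℤ (LinearMap.ker f) = 0 := by
    rw [Module.finrank_eq_zero_iff_isTorsion]
    intro x
    obtain ⟨n, hn, hx⟩ := (isOfFinAddOrder_of_finite x).exists_nsmul_eq_zero
    exact ⟨⟨(n : ℤ), by simpa using hn.ne'⟩, by simpa [Submonoid.smul_def] using hx⟩
  have h1 := (LinearMap.ker f).finrank_quotient_add_finrank
  have h2 := (LinearMap.range f).finrank_quotient_add_finrank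
  have h3 := f.quotKerEquivRange.finrank_eq
  have h0 : Module.finrank ℤ (M ⧸ LinearMap.range f) = 0 := by omega
  rw [Module.finrank_eq_zero_iff_isTorsion] at h0
  exact Module.finite_of_fg_torsion _ h0

/-- If an endomorphism of a finitely generated abelian group has finitely many fixed points, then
it has finitely many twisted conjugacy classes. -/
theorem exists_finite_mul_inv_of_finite_fixedPoints {K : Type*} [CommGroup K] [Group.FG K]
    (φ : K →* K) (hφ : {x | φ x = x}.Finite) :
    ∃ T : Set K, T.Finite ∧ ∀ k, ∃ t ∈ T, ∃ z, k = t * (z * (φ z)⁻¹) := by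
  let f : Additive K →ₗ[ℤ] Additive K :=
    (MonoidHom.toAdditive (MonoidHom.id K / φ)).toIntLinearMap
  have hf (z : K) : f (Additive.ofMul z) = Additive.ofMul (z * (φ z)⁻¹) := by
    simp [f, div_eq_mul_inv]
  have hfin : Finite (LinearMap.ker f) := by
    refine Set.Finite.to_subtype ((hφ.image Additive.ofMul).subset fun x hx => ?_)
    refine ⟨x.toMul, ?_, rfl⟩
    have hx' : f (Additive.ofMul x.toMul) = 0 := hx
    rw [hf, ofMul_eq_zero, mul_inv_eq_one] at hx'
    exact hx'.symm
  have : Module.Finite ℤ (Additive K) := Module.Finite.iff_addGroup_fg.2 inferInstance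
  have := f.finite_quotient_range_of_finite_ker
  refine ⟨Set.range fun q : Additive K ⧸ LinearMap.range f => q.out.toMul,
    Set.finite_range _, fun k => ⟨_, ⟨Submodule.Quotient.mk (Additive.ofMul k), rfl⟩, ?_⟩⟩
  have hq := (Submodule.Quotient.eq (LinearMap.range f)).1
    (Quotient.out_eq (Submodule.Quotient.mk (p := LinearMap.range f) (Additive.ofMul k))).symm
  obtain ⟨z, hz⟩ := hq
  refine ⟨z.toMul, ?_⟩
  rw [← ofMul_toMul z, hf] at hz
  exact Additive.ofMul.injective (eq_add_of_sub_eq' hz.symm)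

/-! ### Finite generation of the lower central series -/

open scoped commutatorElement

/-- Each factor of the lower central series of a finitely generated group is finitely generated,
namely by the commutators of generators of the preceding factor with generators of the group. -/
theorem Subgroup.exists_finite_lowerCentralSeries_le {G : Type*} [Group G] (hG : Group.FG G)
    (n : ℕ) : ∃ S : Set G, S.Finite ∧ S ⊆ (⊤ : Subgroup G).lowerCentralSeries n ∧
      (⊤ : Subgroup G).lowerCentralSeries n ≤
        Subgroup.closure S ⊔ (⊤ : Subgroup G).lowerCentralSeries (n + 1) := by
  obtain ⟨A, hA, hAfin⟩ := Group.fg_iff.1 hG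
  induction n with
  | zero => exact ⟨A, hAfin, by simp, by simp [hA]⟩
  | succ n ih =>
    obtain ⟨S, hSfin, hSle, hS⟩ := ih
    have hS' : Set.image2 (fun s a => ⁅s, a⁆) S A ⊆
        (⊤ : Subgroup G).lowerCentralSeries (n + 1) := by
      rintro _ ⟨s, hs, a, -, rfl⟩
      exact Subgroup.commutator_mem_commutator (hSle hs) (Subgroup.mem_top a)
    refine ⟨_, hSfin.image2 _ hAfin, hS', ?_⟩
    set M := Subgroup.closure (Set.image2 (fun s a => ⁅s, a⁆) S A) ⊔
      (⊤ : Subgroup G).lowerCentralSeries (n + 1 + 1) with hM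
    have hMle : M ≤ (⊤ : Subgroup G).lowerCentralSeries (n + 1) :=
      sup_le ((Subgroup.closure_le _).2 hS')
        (Subgroup.lowerCentralSeries_antitone _ (Nat.le_succ _))
    have hcomm {m : G} (hm : m ∈ (⊤ : Subgroup G).lowerCentralSeries (n + 1)) (g : G) :
        ⁅m, g⁆ ∈ M :=
      le_sup_right (a := Subgroup.closure _)
        (Subgroup.commutator_mem_commutator hm (Subgroup.mem_top g))
    have hnormal : M.Normal := ⟨fun m hm g => by
      have := M.mul_mem (M.inv_mem (hcomm (hMle hm) g)) hm
      rwa [commutatorElement_inv, commutatorElement_def, inv_mul_cancel_right] at this⟩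
    have hmk {x g : G} (h : ⁅x, g⁆ ∈ M) :
        QuotientGroup.mk' M g * QuotientGroup.mk' M x =
          QuotientGroup.mk' M x * QuotientGroup.mk' M g := by
      have h' : QuotientGroup.mk' M ⁅x, g⁆ = 1 := (QuotientGroup.eq_one_iff _).2 h
      rw [map_commutatorElement, commutatorElement_eq_one_iff_mul_comm] at h'
      exact h'.symm
    -- Modulo `M`, each `s ∈ S` commutes with the generators of `G`, hence is central.
    have hSc : Subgroup.closure S ≤ (Subgroup.center (G ⧸ M)).comap (QuotientGroup.mk' M) := by
      refine (Subgroup.closure_le _).2 fun s hs => ?_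
      have hle : Subgroup.closure A ≤ (Subgroup.centralizer
          {QuotientGroup.mk' M s}).comap (QuotientGroup.mk' M) := by
        refine (Subgroup.closure_le _).2 fun a ha => ?_
        refine Subgroup.mem_centralizer_singleton_iff.2 (hmk ?_)
        exact le_sup_left (a := Subgroup.closure _)
          (Subgroup.subset_closure (Set.mem_image2_of_mem hs ha))
      refine Subgroup.mem_center_iff.2 fun q => ?_
      obtain ⟨g, rfl⟩ := QuotientGroup.mk'_surjective M q
      exact Subgroup.mem_centralizer_singleton_iff.1 (hle (hA ▸ Subgroup.mem_top g))
    have hc : (⊤ : Subgroup G).lowerCentralSeries n ≤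
        (Subgroup.center (G ⧸ M)).comap (QuotientGroup.mk' M) := by
      refine hS.trans (sup_le hSc fun x hx => Subgroup.mem_center_iff.2 fun q => ?_)
      obtain ⟨g, rfl⟩ := QuotientGroup.mk'_surjective M q
      exact hmk (hcomm hx g)
    rw [Subgroup.lowerCentralSeries_succ, Subgroup.commutator_le]
    intro x hx g _
    refine (QuotientGroup.eq_one_iff _).1 ?_
    change QuotientGroup.mk' M ⁅x, g⁆ = 1
    rw [map_commutatorElement, commutatorElement_eq_one_iff_mul_comm]
    exact (Subgroup.mem_center_iff.1 (hc hx) _).symm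

/-- The last nontrivial term of the lower central series of a finitely generated nilpotent group
is finitely generated. -/
theorem Subgroup.fg_lowerCentralSeries_of_succ_eq_bot {G : Type*} [Group G] (hG : Group.FG G)
    {n : ℕ} (hn : (⊤ : Subgroup G).lowerCentralSeries (n + 1) = ⊥) :
    ((⊤ : Subgroup G).lowerCentralSeries n).FG := by
  obtain ⟨S, hfin, hSle, hS⟩ := Subgroup.exists_finite_lowerCentralSeries_le hG n
  rw [hn, sup_bot_eq] at hS
  exact (Subgroup.fg_iff _).2 ⟨S, le_antisymm ((Subgroup.closure_le _).2 hSle) hS, hfin⟩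

/-! ### Passing to a central quotient -/

/-- If `φ` has finitely many fixed points and finitely many twisted conjugacy classes on an
invariant normal subgroup `K`, then it has finitely many fixed points on `G ⧸ K`. -/
theorem finite_fixedPoints_quotient {G : Type*} [Group G] {K : Subgroup G} [K.Normal]
    (φ : G →* G) (hK : K ≤ K.comap φ) (hφ : {x | φ x = x}.Finite) {T : Set G} (hT : T.Finite)
    (hTK : ∀ k ∈ K, ∃ t ∈ T, ∃ z ∈ K, k = z * t * (φ z)⁻¹) :
    {q | QuotientGroup.map K K φ hK q = q}.Finite := by
  -- For fixed `t`, the solutions of `φ y = y * t` form at most one coset of the fixed points of `φ`.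
  have hfib (t : G) : {y | φ y = y * t}.Finite := by
    rcases Set.eq_empty_or_nonempty {y | φ y = y * t} with h | ⟨y₀, hy₀⟩
    · simp [h]
    · refine (hφ.image (· * y₀)).subset fun y hy => ⟨y * y₀⁻¹, ?_, by simp⟩
      have h1 : φ y = y * t := hy
      have h2 : φ y₀ = y₀ * t := hy₀
      simp [h1, h2]
  refine (hT.biUnion fun t _ => (hfib t).image (QuotientGroup.mk : G → G ⧸ K)).subset ?_
  intro q hq
  obtain ⟨x, rfl⟩ := QuotientGroup.mk_surjective q
  have hx : (x : G ⧸ K) = (φ x : G) := Eq.symm hq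
  obtain ⟨t, ht, z, hz, h⟩ := hTK _ (QuotientGroup.eq.1 hx)
  refine Set.mem_biUnion ht ⟨x * z, ?_, ?_⟩
  · have : φ x = x * (z * t * (φ z)⁻¹) := by rw [← h]; group
    simp [this, mul_assoc]
  · exact (QuotientGroup.eq.2 (by simpa using hz)).symm

/-- If `φ` has finitely many twisted conjugacy classes on an invariant central subgroup `K` and
on `G ⧸ K`, then it has finitely many twisted conjugacy classes on `G`. -/
theorem exists_finite_twistedConj_of_quotient {G : Type*} [Group G] {K : Subgroup G} [K.Normal]
    (hcen : K ≤ Subgroup.center G) (φ : G →* G) (hK : K ≤ K.comap φ) {T : Set G} (hT : T.Finite)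
    (hTK : ∀ k ∈ K, ∃ t ∈ T, ∃ z ∈ K, k = z * t * (φ z)⁻¹) {S : Set (G ⧸ K)} (hS : S.Finite)
    (hSK : ∀ q, ∃ s ∈ S, ∃ z, q = z * s * (QuotientGroup.map K K φ hK z)⁻¹) :
    ∃ R : Set G, R.Finite ∧ ∀ x, ∃ r ∈ R, ∃ z, x = z * r * (φ z)⁻¹ := by
  refine ⟨Set.image2 (fun s t => s.out * t) S T, hS.image2 _ hT, fun x => ?_⟩
  obtain ⟨s, hs, q, hq⟩ := hSK x
  obtain ⟨z, rfl⟩ := QuotientGroup.mk_surjective q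
  have hx : ((z * s.out * (φ z)⁻¹ : G) : G ⧸ K) = x := by
    rw [hq]
    simp
  obtain ⟨t, ht, w, hw, h⟩ := hTK _ (QuotientGroup.eq.1 hx)
  refine ⟨_, Set.mem_image2_of_mem hs ht, z * w, ?_⟩
  set k := (z * s.out * (φ z)⁻¹)⁻¹ * x with hk
  have hkc : ∀ g, g * k = k * g := Subgroup.mem_center_iff.1 (hcen (QuotientGroup.eq.1 hx))
  have hwc := Subgroup.mem_center_iff.1 (hcen hw)
  calc x = z * s.out * ((φ z)⁻¹ * k) := by rw [hk]; group
    _ = z * (s.out * w) * t * (φ w)⁻¹ * (φ z)⁻¹ := by rw [hkc, h]; group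
    _ = z * w * (s.out * t) * (φ (z * w))⁻¹ := by rw [hwc, map_mul]; group

/-! ### Finitely generated nilpotent groups -/

/-- An endomorphism with finitely many fixed points on a finitely generated nilpotent group has
finitely many twisted conjugacy classes. -/
theorem exists_finite_twistedConj_of_isNilpotent {G : Type*} [Group G] (hG : Group.FG G)
    (hnil : Group.IsNilpotent G) (φ : G →* G) (hφ : {x | φ x = x}.Finite) :
    ∃ R : Set G, R.Finite ∧ ∀ x, ∃ r ∈ R, ∃ z, x = z * r * (φ z)⁻¹ := by
  obtain ⟨n, hn⟩ := Subgroup.nilpotent_iff_lowerCentralSeries.1 hnil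
  clear hnil
  induction n generalizing G with
  | zero =>
    refine ⟨{1}, Set.finite_singleton _, fun x => ⟨1, rfl, 1, ?_⟩⟩
    have hx : x ∈ (⊤ : Subgroup G).lowerCentralSeries 0 := Subgroup.mem_top x
    simpa [hn] using hx
  | succ n ih =>
    set K := (⊤ : Subgroup G).lowerCentralSeries n with hKdef
    have hcen : K ≤ Subgroup.center G := by
      rwa [← Subgroup.commutator_top_right_eq_bot_iff_le_center]
    have hK : K ≤ K.comap φ := by
      rw [← Subgroup.map_le_iff_le_comap, hKdef, Subgroup.map_lowerCentralSeries]
      exact Subgroup.lowerCentralSeries_mono n le_top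
    obtain ⟨T, hT, hTK⟩ : ∃ T : Set G, T.Finite ∧
        ∀ k ∈ K, ∃ t ∈ T, ∃ z ∈ K, k = z * t * (φ z)⁻¹ := by
      let _ : CommGroup K :=
        { (inferInstance : Group K) with
          mul_comm := fun a b => Subtype.ext (Subgroup.mem_center_iff.1 (hcen b.2) a) }
      have : Group.FG K :=
        (Group.fg_iff_subgroup_fg K).2 (Subgroup.fg_lowerCentralSeries_of_succ_eq_bot hG hn)
      let ψ : K →* K := (φ.comp K.subtype).codRestrict K fun k => hK k.2
      have hψ : {x | ψ x = x}.Finite :=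
        (hφ.preimage Subtype.val_injective.injOn).subset fun x hx => congrArg Subtype.val hx
      obtain ⟨T, hT, h⟩ := exists_finite_mul_inv_of_finite_fixedPoints ψ hψ
      refine ⟨Subtype.val '' T, hT.image _, fun k hk => ?_⟩
      obtain ⟨t, ht, z, hz⟩ := h ⟨k, hk⟩
      refine ⟨t, ⟨t, ht, rfl⟩, z, z.2, ?_⟩
      rw [← mul_assoc, mul_comm t z] at hz
      exact congrArg Subtype.val hz
    obtain ⟨S, hS, hSK⟩ := ih (G := G ⧸ K) inferInstance (QuotientGroup.map K K φ hK)
      (finite_fixedPoints_quotient φ hK hφ hT hTK) (by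
        rw [← Subgroup.map_top_of_surjective _ (QuotientGroup.mk'_surjective K),
          ← Subgroup.map_lowerCentralSeries, ← hKdef]
        exact QuotientGroup.map_mk'_self K)
    exact exists_finite_twistedConj_of_quotient hcen φ hK hT hTK hS hSK

/-- If some twisted stabiliser of an endomorphism of a finitely generated nilpotent group is
finite, then its Reidemeister number is finite. -/
theorem reidemeisterNumber_ne_top_of_finite_twistedStabiliser {G : Type*} [Group G]
    (hG : Group.FG G) (hnil : Group.IsNilpotent G) (φ : G →* G) (n : G)
    (hn : (twistedStabiliser φ n : Set G).Finite) : reidemeisterNumber φ ≠ ⊤ := by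
  let ψ : G →* G := (MulAut.conj n).toMonoidHom.comp φ
  have hψ (x : G) : ψ x = n * φ x * n⁻¹ := rfl
  have hfix : {x | ψ x = x}.Finite := by
    refine hn.subset fun x hx => ?_
    have hx' : n * φ x * n⁻¹ = x := hx
    change x * n * (φ x)⁻¹ = n
    rw [mul_inv_eq_iff_eq_mul, ← eq_mul_inv_iff_mul_eq, hx']
  obtain ⟨R, hR, h⟩ := exists_finite_twistedConj_of_isNilpotent hG hnil ψ hfix
  have hfin : Finite (Quotient (twistedConjSetoid φ)) := by
    refine Set.finite_univ_iff.1 ((hR.image fun r =>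
      (Quotient.mk (twistedConjSetoid φ) (r * n))).subset fun q _ => ?_)
    induction q using Quotient.inductionOn with | h x => ?_
    obtain ⟨r, hr, z, hz⟩ := h (x * n⁻¹)
    refine ⟨r, hr, (Quotient.sound (s := twistedConjSetoid φ)
      (show ∃ z, x = z * (r * n) * (φ z)⁻¹ from
      ⟨z, ?_⟩)).symm⟩
    rw [hψ, mul_inv_eq_iff_eq_mul] at hz
    rw [hz]
    group
  simpa [reidemeisterNumber] using hfin

theorem mainTheorem5 {N : Type*} [Group N] (hfg : Group.FG N) (htf : IsTorsionFreeGroup N)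
    (hnil : Group.IsNilpotent N) (φ : N →* N) (hφ : reidemeisterNumber φ = ⊤) :
    (∀ n : N, (twistedStabiliser φ n : Set N).Infinite) ∧ (∃ x : N, x ≠ 1 ∧ φ x = x) := by
  have hinf (n : N) : (twistedStabiliser φ n : Set N).Infinite := fun h =>
    reidemeisterNumber_ne_top_of_finite_twistedStabiliser hfg hnil φ n h hφ
  obtain ⟨x, hx, hx1⟩ := (hinf 1).exists_notMem_finite (Set.finite_singleton 1)
  refine ⟨hinf, x, hx1, ?_⟩
  have hx' : x * 1 * (φ x)⁻¹ = 1 := hx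
  rw [mul_one, mul_inv_eq_one] at hx'
  exact hx'.symm
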